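/- Let $A$ be an $f$-algebra, that is, a real Riesz space with an associative bilinear multiplication (a unit is not assumed) such that $ab\ge 0$ whenever $a,b\ge 0$, and such that $a\wedge b=0$ and $c\ge 0$ imply $(ca)\wedge b=(ac)\wedge b=0$. Let $A^{\sim}$ be the order dual of $A$, i.e. the Riesz space of all order bounded linear functionals on $A$, and assume that $A^{\sim}$ separates the points of $A$: if $f(a)=0$ for all $f\in A^{\sim}$, then $a=0$. Let $(A^{\sim})^{\sim}_{n}$ be the order continuous dual of $A^{\sim}$, i.e. the Riesz space of all order bounded and order continuous linear functionals on $A^{\sim}$. For $f\in A^{\sim}$, $a\in A$ and $F\in (A^{\sim})^{\sim}_{n}$ define $f\cdot a\in A^{\sim}$ by $(f\cdot a)(b)=f(ab)$ for $b\in A$, and $F\cdot f\in A^{\sim}$ by $(F\cdot f)(a)=F(f\cdot a)$ for $a\in A$. Write $u\perp v$ if $|u|\wedge|v|=0$. Then for all $f\in A^{\sim}$ and $F\in (A^{\sim})^{\sim}_{n}$, $$|F\cdot f|=|F|\cdot |f|.$$ Moreover, if $f,g\in A^{\sim}$ and $f\perp g$, then $F\cdot f\perp G\cdot g$ for all $F,G\in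 (A^{\sim})^{\sim}_{n}$. -/

import Mathlib

universe u

/-- A real Riesz space (vector lattice) is a real vector space `E` with a lattice order satisfying
`[IsOrderedAddMonoid E]` and `[IsOrderedModule ℝ E]`. Two elements are disjoint, `x ⊥ y`, if
`|x| ⊓ |y| = 0`. -/
def RieszDisjoint {E : Type u} [AddCommGroup E] [Lattice E] (x y : E) : Prop :=
  |x| ⊓ |y| = 0

/-- An `f`-algebra: a Riesz space with an associative bilinear multiplication (not assumed
commutative or unital; associativity and bilinearity are `NonUnitalRing`, `IsScalarTower` and
`SMulCommClass`) such that products of nonnegative elements are nonnegative and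
`a ⊓ b = 0`, `0 ≤ c` imply `(c * a) ⊓ b = 0` and `(a * c) ⊓ b = 0`. -/
class IsFAlgebra (A : Type u) [NonUnitalRing A] [Lattice A] [IsOrderedAddMonoid A] [Module ℝ A]
    [IsOrderedModule ℝ A] [IsScalarTower ℝ A A] [SMulCommClass ℝ A A] : Prop where
  mul_nonneg : ∀ a b : A, 0 ≤ a → 0 ≤ b → 0 ≤ a * b
  mul_left_inf : ∀ a b c : A, a ⊓ b = 0 → 0 ≤ c → (c * a) ⊓ b = 0
  mul_right_inf : ∀ a b c : A, a ⊓ b = 0 → 0 ≤ c → (a * c) ⊓ b = 0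

/-! ### The order dual of a Riesz space -/

section Dual

variable (E : Type u) [AddCommGroup E] [Lattice E] [IsOrderedAddMonoid E] [Module ℝ E]
  [IsOrderedModule ℝ E]

/-- The linear functionals that are bounded on every order interval. -/
def orderBoundedFunctionals : Submodule ℝ (E →ₗ[ℝ] ℝ) where
  carrier := {f | ∀ a b : E, ∃ c d : ℝ, ∀ x, a ≤ x → x ≤ b → c ≤ f x ∧ f x ≤ d}
  add_mem' := by
    intro f g hf hg a b
    obtain ⟨c, d, h⟩ := hf a b
    obtain ⟨c', d', h'⟩ := hg a b
    exact ⟨c + c', d + d', fun x hx hx' => ⟨add_le_add (h x hx hx').1 (h' x hx hx').1,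
      add_le_add (h x hx hx').2 (h' x hx hx').2⟩⟩
  zero_mem' := fun a b => ⟨0, 0, fun x _ _ => by simp⟩
  smul_mem' := by
    intro r f hf a b
    obtain ⟨c, d, h⟩ := hf a b
    rcases le_total 0 r with hr | hr
    · exact ⟨r * c, r * d, fun x hx hx' => ⟨mul_le_mul_of_nonneg_left (h x hx hx').1 hr,
        mul_le_mul_of_nonneg_left (h x hx hx').2 hr⟩⟩
    · exact ⟨r * d, r * c, fun x hx hx' => ⟨mul_le_mul_of_nonpos_left (h x hx hx').2 hr,
        mul_le_mul_of_nonpos_left (h x hx hx').1 hr⟩⟩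

/-- The order dual `E~`: all order bounded linear functionals on `E`. It is ordered by
`f ≤ g ↔ ∀ x ≥ 0, f x ≤ g x`, and is a Riesz space. -/
def RieszDual : Type u := ↥(orderBoundedFunctionals E)

namespace RieszDual

noncomputable instance : AddCommGroup (RieszDual E) :=
  inferInstanceAs (AddCommGroup ↥(orderBoundedFunctionals E))

noncomputable instance : Module ℝ (RieszDual E) :=
  inferInstanceAs (Module ℝ ↥(orderBoundedFunctionals E))

variable {E}

/-- The underlying linear functional. -/
def toLin (f : RieszDual E) : E →ₗ[ℝ] ℝ := f.1

instance : CoeFun (RieszDual E) (fun _ => E → ℝ) := ⟨fun f => f.toLin⟩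

/-- An order bounded linear functional as an element of the order dual. -/
def mk (f : E →ₗ[ℝ] ℝ)
    (hf : ∀ a b : E, ∃ c d : ℝ, ∀ x, a ≤ x → x ≤ b → c ≤ f x ∧ f x ≤ d) : RieszDual E :=
  ⟨f, hf⟩

@[simp] theorem mk_apply (f : E →ₗ[ℝ] ℝ) (hf) (x : E) : (mk f hf) x = f x := rfl
@[simp] theorem add_apply (f g : RieszDual E) (x : E) : (f + g) x = f x + g x := rfl
@[simp] theorem sub_apply (f g : RieszDual E) (x : E) : (f - g) x = f x - g x := rfl
@[simp] theorem neg_apply (f : RieszDual E) (x : E) : (-f) x = - f x := rfl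
@[simp] theorem zero_apply (x : E) : (0 : RieszDual E) x = 0 := rfl
@[simp] theorem smul_apply (r : ℝ) (f : RieszDual E) (x : E) : (r • f) x = r * f x := rfl

theorem bounded (f : RieszDual E) (a b : E) :
    ∃ c d : ℝ, ∀ x, a ≤ x → x ≤ b → c ≤ f x ∧ f x ≤ d := f.2 a b

theorem ext_apply {f g : RieszDual E} (h : ∀ x, f x = g x) : f = g :=
  Subtype.ext (LinearMap.ext h)

theorem ext_nonneg {f g : RieszDual E} (h : ∀ x, 0 ≤ x → f x = g x) : f = g := by
  apply ext_apply
  intro x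
  rw [← posPart_sub_negPart x, map_sub, map_sub, h _ (posPart_nonneg x), h _ (negPart_nonneg x)]

instance : PartialOrder (RieszDual E) where
  le f g := ∀ x : E, 0 ≤ x → f x ≤ g x
  le_refl f x _ := le_rfl
  le_trans f g h h₁ h₂ x hx := (h₁ x hx).trans (h₂ x hx)
  le_antisymm f g h₁ h₂ := ext_nonneg fun x hx => le_antisymm (h₁ x hx) (h₂ x hx)

theorem le_def {f g : RieszDual E} : f ≤ g ↔ ∀ x : E, 0 ≤ x → f x ≤ g x := Iff.rfl

instance : IsOrderedAddMonoid (RieszDual E) where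
  add_le_add_left f g h k x hx := by simpa using h x hx

instance : IsOrderedModule ℝ (RieszDual E) where
  smul_le_smul_of_nonneg_left := fun r hr f g h x hx => by
    simpa using mul_le_mul_of_nonneg_left (h x hx) hr
  smul_le_smul_of_nonneg_right := fun f hf r s h x hx => by
    simpa using mul_le_mul_of_nonneg_right h (by simpa using hf x hx)

/-- `sup {f y | 0 ≤ y ≤ x}`, the value of `f⁺` at `x ≥ 0`. -/
noncomputable def posVal (f : RieszDual E) (x : E) : ℝ := sSup (f '' Set.Icc 0 x)

theorem bddAbove_image (f : RieszDual E) (x : E) : BddAbove (f '' Set.Icc 0 x) := by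
  obtain ⟨c, d, h⟩ := f.bounded 0 x
  refine ⟨d, ?_⟩
  rintro _ ⟨y, hy, rfl⟩
  exact (h y hy.1 hy.2).2

theorem le_posVal (f : RieszDual E) {x y : E} (hy : 0 ≤ y) (hyx : y ≤ x) : f y ≤ f.posVal x :=
  le_csSup (f.bddAbove_image x) ⟨y, ⟨hy, hyx⟩, rfl⟩

theorem posVal_le (f : RieszDual E) {x : E} (hx : 0 ≤ x) {c : ℝ}
    (h : ∀ y, 0 ≤ y → y ≤ x → f y ≤ c) : f.posVal x ≤ c := by
  have hne : (Set.Icc 0 x).Nonempty := ⟨0, le_rfl, hx⟩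
  apply csSup_le (hne.image _)
  rintro _ ⟨y, hy, rfl⟩
  exact h y hy.1 hy.2

theorem posVal_nonneg (f : RieszDual E) {x : E} (hx : 0 ≤ x) : 0 ≤ f.posVal x := by
  simpa using f.le_posVal le_rfl hx

theorem posVal_zero (f : RieszDual E) : f.posVal 0 = 0 :=
  le_antisymm (f.posVal_le le_rfl fun y h h' => by simp [le_antisymm h' h])
    (f.posVal_nonneg le_rfl)

theorem posVal_add (f : RieszDual E) {x y : E} (hx : 0 ≤ x) (hy : 0 ≤ y) :
    f.posVal (x + y) = f.posVal x + f.posVal y := by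
  apply le_antisymm
  · apply f.posVal_le (add_nonneg hx hy)
    intro z hz hzxy
    have h1 : z = z ⊓ x + (z - z ⊓ x) := by abel
    have h2 : z - z ⊓ x ≤ y := by
      rw [sub_le_iff_le_add, add_inf]
      exact le_inf (by simpa using hy) (by rwa [add_comm])
    rw [h1, map_add]
    exact add_le_add (f.le_posVal (le_inf hz hx) inf_le_right)
      (f.le_posVal (sub_nonneg.2 inf_le_left) h2)
  · rw [← le_sub_iff_add_le]
    apply f.posVal_le hx
    intro z hz hzx
    rw [le_sub_iff_add_le, add_comm, ← le_sub_iff_add_le]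
    apply f.posVal_le hy
    intro w hw hwy
    rw [le_sub_iff_add_le, ← map_add]
    exact f.le_posVal (add_nonneg hw hz) (by rw [add_comm]; exact add_le_add hzx hwy)

theorem posVal_smul (f : RieszDual E) {r : ℝ} (hr : 0 ≤ r) {x : E} (hx : 0 ≤ x) :
    f.posVal (r • x) = r * f.posVal x := by
  rcases hr.eq_or_lt with rfl | hr'
  · simp [posVal_zero]
  apply le_antisymm
  · apply f.posVal_le (smul_nonneg hr hx)
    intro y hy hyx
    have h1 : r⁻¹ • y ≤ x := by
      have := smul_le_smul_of_nonneg_left hyx (inv_nonneg.2 hr)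
      rwa [smul_smul, inv_mul_cancel₀ hr'.ne', one_smul] at this
    have h2 := f.le_posVal (smul_nonneg (inv_nonneg.2 hr) hy) h1
    rw [map_smul, smul_eq_mul, inv_mul_le_iff₀ hr'] at h2
    exact h2
  · rw [← le_div_iff₀' hr']
    apply f.posVal_le hx
    intro y hy hyx
    rw [le_div_iff₀' hr', ← smul_eq_mul, ← map_smul]
    exact f.le_posVal (smul_nonneg hr hy) (smul_le_smul_of_nonneg_left hyx hr)

theorem posVal_sub_eq (f : RieszDual E) {a b c d : E} (ha : 0 ≤ a) (hb : 0 ≤ b) (hc : 0 ≤ c)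
    (hd : 0 ≤ d) (h : a - b = c - d) :
    f.posVal a - f.posVal b = f.posVal c - f.posVal d := by
  have h1 : a + d = c + b := by rwa [sub_eq_sub_iff_add_eq_add] at h
  have h2 := f.posVal_add ha hd
  rw [h1, f.posVal_add hc hb] at h2
  linarith

/-- The positive part `f⁺` of `f` as a linear functional. -/
noncomputable def posLin (f : RieszDual E) : E →ₗ[ℝ] ℝ where
  toFun x := f.posVal x⁺ - f.posVal x⁻
  map_add' x y := by
    have h := f.posVal_sub_eq (posPart_nonneg (x + y)) (negPart_nonneg (x + y))
      (add_nonneg (posPart_nonneg x) (posPart_nonneg y))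
      (add_nonneg (negPart_nonneg x) (negPart_nonneg y))
      (by rw [posPart_sub_negPart, add_sub_add_comm, posPart_sub_negPart, posPart_sub_negPart])
    rw [h, f.posVal_add (posPart_nonneg x) (posPart_nonneg y),
      f.posVal_add (negPart_nonneg x) (negPart_nonneg y)]
    ring
  map_smul' r x := by
    rcases le_total 0 r with hr | hr
    · have h := f.posVal_sub_eq (posPart_nonneg (r • x)) (negPart_nonneg (r • x))
        (smul_nonneg hr (posPart_nonneg x)) (smul_nonneg hr (negPart_nonneg x))
        (by rw [posPart_sub_negPart, ← smul_sub, posPart_sub_negPart])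
      rw [h, f.posVal_smul hr (posPart_nonneg x), f.posVal_smul hr (negPart_nonneg x)]
      simp only [RingHom.id_apply, smul_eq_mul]
      ring
    · have hr' : 0 ≤ -r := neg_nonneg.2 hr
      have h := f.posVal_sub_eq (posPart_nonneg (r • x)) (negPart_nonneg (r • x))
        (smul_nonneg hr' (negPart_nonneg x)) (smul_nonneg hr' (posPart_nonneg x))
        (by rw [posPart_sub_negPart, ← smul_sub, ← neg_sub x⁺ x⁻, posPart_sub_negPart,
              neg_smul_neg])
      rw [h, f.posVal_smul hr' (posPart_nonneg x), f.posVal_smul hr' (negPart_nonneg x)]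
      simp only [RingHom.id_apply, smul_eq_mul]
      ring

theorem posLin_apply (f : RieszDual E) {x : E} (hx : 0 ≤ x) : f.posLin x = f.posVal x := by
  change f.posVal x⁺ - f.posVal x⁻ = _
  rw [posPart_of_nonneg hx, negPart_of_nonneg hx, posVal_zero, sub_zero]

theorem bounded_of_nonneg (f : E →ₗ[ℝ] ℝ) (hf : ∀ x, 0 ≤ x → 0 ≤ f x) (a b : E) :
    ∃ c d : ℝ, ∀ x, a ≤ x → x ≤ b → c ≤ f x ∧ f x ≤ d := by
  refine ⟨f a, f b, fun x hx hx' => ⟨?_, ?_⟩⟩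
  · simpa using hf _ (sub_nonneg.2 hx)
  · simpa using hf _ (sub_nonneg.2 hx')

/-- The positive part of `f`, given by `x ↦ sup {f y | 0 ≤ y ≤ x}` for `x ≥ 0`. -/
noncomputable def pos (f : RieszDual E) : RieszDual E :=
  mk f.posLin (bounded_of_nonneg _ fun x hx => by
    rw [f.posLin_apply hx]; exact f.posVal_nonneg hx)

theorem pos_apply (f : RieszDual E) {x : E} (hx : 0 ≤ x) : f.pos x = f.posVal x :=
  f.posLin_apply hx

theorem le_pos (f : RieszDual E) : f ≤ f.pos := fun x hx => by
  rw [f.pos_apply hx]; exact f.le_posVal hx le_rfl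

theorem pos_nonneg (f : RieszDual E) : 0 ≤ f.pos := fun x hx => by
  rw [f.pos_apply hx]; exact f.posVal_nonneg hx

theorem pos_le {f g : RieszDual E} (h : f ≤ g) (hg : 0 ≤ g) : f.pos ≤ g := fun x hx => by
  rw [f.pos_apply hx]
  refine f.posVal_le hx fun y hy hyx => (h y hy).trans ?_
  have := hg (x - y) (sub_nonneg.2 hyx)
  simpa using this

noncomputable instance : Lattice (RieszDual E) where
  sup f g := (f - g).pos + g
  le_sup_left f g := sub_le_iff_le_add.1 (f - g).le_pos
  le_sup_right f g := le_add_of_nonneg_left (f - g).pos_nonneg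
  sup_le f g h hf hg := le_sub_iff_add_le.1
    (pos_le (sub_le_sub_right hf g) (sub_nonneg.2 hg))
  inf f g := f - (f - g).pos
  inf_le_left f g := sub_le_self f (f - g).pos_nonneg
  inf_le_right f g := by
    have := (f - g).le_pos
    exact sub_le_comm.1 this
  le_inf h f g hf hg := le_sub_comm.1 (pos_le (sub_le_sub_left hg f) (sub_nonneg.2 hf))

theorem sup_def (f g : RieszDual E) : f ⊔ g = (f - g).pos + g := rfl

theorem inf_def (f g : RieszDual E) : f ⊓ g = f - (f - g).pos := rfl

theorem nonneg_apply {f : RieszDual E} (hf : 0 ≤ f) {x : E} (hx : 0 ≤ x) : 0 ≤ f x := hf x hx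

theorem mono {f : RieszDual E} (hf : 0 ≤ f) {x y : E} (h : x ≤ y) : f x ≤ f y := by
  have := hf (y - x) (sub_nonneg.2 h)
  simpa using this

end RieszDual

end Dual

/-! ### The order continuous dual -/

/-- A net `x` indexed by a directed set `ι` converges in order to `0` if there is a net
`y i ↓ 0` with `|x i| ≤ y i` for all `i`. -/
def OrderTendstoZero {E : Type*} [AddCommGroup E] [Lattice E] {ι : Type*} [Preorder ι]
    (x : ι → E) : Prop :=
  ∃ y : ι → E, Antitone y ∧ IsGLB (Set.range y) 0 ∧ ∀ i, |x i| ≤ y i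

section NormalDual

variable (E : Type u) [AddCommGroup E] [Lattice E] [IsOrderedAddMonoid E] [Module ℝ E]
  [IsOrderedModule ℝ E]

/-- `f` maps every net (indexed by a nonempty directed set) that converges to `0` in order to a
net of reals that converges to `0` in order. Index sets in the universe of `E` suffice to test
this, as a net may be reindexed by a set of pairs of elements of `E`. -/
def IsOrderContinuous {E : Type u} [AddCommGroup E] [Lattice E] [IsOrderedAddMonoid E]
    [Module ℝ E] [IsOrderedModule ℝ E] (f : RieszDual E) : Prop :=
  ∀ (ι : Type u) [Preorder ι] [IsDirected ι (· ≤ ·)] [Nonempty ι] (x : ι → E),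
    OrderTendstoZero x → OrderTendstoZero (fun i => f (x i))

/-- The order bounded functionals that are order continuous. -/
def orderContinuousFunctionals : Submodule ℝ (RieszDual E) where
  carrier := {f | IsOrderContinuous f}
  add_mem' := by
    intro f g hf hg ι _ _ _ x hx
    obtain ⟨s, hs, hs0, hsx⟩ := hf ι x hx
    obtain ⟨t, ht, ht0, htx⟩ := hg ι x hx
    refine ⟨fun i => s i + t i, fun i j h => add_le_add (hs h) (ht h), ⟨?_, ?_⟩, fun i =>
      (abs_add_le _ _).trans (add_le_add (hsx i) (htx i))⟩
    · rintro _ ⟨i, rfl⟩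
      exact add_nonneg (hs0.1 ⟨i, rfl⟩) (ht0.1 ⟨i, rfl⟩)
    · intro c hc
      have h1 : ∀ i j, c ≤ s i + t j := fun i j => by
        obtain ⟨k, hik, hjk⟩ := exists_ge_ge i j
        exact (hc ⟨k, rfl⟩).trans (add_le_add (hs hik) (ht hjk))
      apply hs0.2
      rintro _ ⟨i, rfl⟩
      have : c - s i ≤ 0 := by
        apply ht0.2
        rintro _ ⟨j, rfl⟩
        linarith [h1 i j]
      linarith
  zero_mem' := by
    intro ι _ _ _ x _
    exact ⟨fun _ => 0, fun _ _ _ => le_rfl, by simp, by simp⟩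
  smul_mem' := by
    intro r f hf ι _ _ _ x hx
    obtain ⟨s, hs, hs0, hsx⟩ := hf ι x hx
    rcases eq_or_ne r 0 with rfl | hr
    · exact ⟨fun _ => 0, fun _ _ _ => le_rfl, by simp, by simp⟩
    have hr' : 0 < |r| := abs_pos.2 hr
    refine ⟨fun i => |r| * s i, fun i j h => mul_le_mul_of_nonneg_left (hs h) hr'.le,
      ⟨?_, ?_⟩, fun i => ?_⟩
    · rintro _ ⟨i, rfl⟩
      exact mul_nonneg hr'.le (hs0.1 ⟨i, rfl⟩)
    · intro c hc
      have : c / |r| ≤ 0 := by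
        apply hs0.2
        rintro _ ⟨i, rfl⟩
        rw [div_le_iff₀' hr']
        exact hc ⟨i, rfl⟩
      simpa using (div_le_iff₀' hr').1 this
    · change |r * f (x i)| ≤ |r| * s i
      rw [abs_mul]
      exact mul_le_mul_of_nonneg_left (hsx i) hr'.le

/-- The order continuous dual `E~_n`: the order continuous elements of the order dual `E~`,
with the order and the lattice operations of `E~`. -/
def NormalDual : Type u := ↥(orderContinuousFunctionals E)

variable {E}

theorem IsOrderContinuous.pos {f : RieszDual E} (hf : IsOrderContinuous f) :
    IsOrderContinuous f.pos := by
  intro ι _ _ _ x ⟨y, hy, hy0, hxy⟩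
  have hyn : ∀ i, 0 ≤ y i := fun i => hy0.1 ⟨i, rfl⟩
  refine ⟨fun i => f.pos (y i), fun i j h => RieszDual.mono f.pos_nonneg (hy h), ⟨?_, ?_⟩,
    fun i => ?_⟩
  · rintro _ ⟨i, rfl⟩
    exact RieszDual.nonneg_apply f.pos_nonneg (hyn i)
  · intro c hc
    obtain ⟨i₀⟩ := ‹Nonempty ι›
    have key : f.posVal (y i₀) ≤ f.pos (y i₀) - c := by
      apply f.posVal_le (hyn i₀)
      intro z hz hzy
      obtain ⟨s, hs, hs0, hsz⟩ := hf ι (fun j => z ⊓ y j) ⟨fun j => z ⊓ y j,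
        fun i j h => inf_le_inf_left z (hy h), ⟨by
          rintro _ ⟨j, rfl⟩
          exact le_inf hz (hyn j), fun w hw => hy0.2 (by
            rintro _ ⟨j, rfl⟩
            exact (hw ⟨j, rfl⟩).trans inf_le_right)⟩,
        fun j => (abs_of_nonneg (le_inf hz (hyn j))).le⟩
      have : c - (f.pos (y i₀) - f z) ≤ 0 := by
        apply hs0.2
        rintro _ ⟨j, rfl⟩
        obtain ⟨k, hik, hjk⟩ := exists_ge_ge i₀ j
        have h1 : z - z ⊓ y k ≤ y i₀ - y k := by
          rw [sub_le_iff_le_add, add_inf]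
          refine le_inf ?_ (by simpa using hzy)
          have := hy hik
          rw [← sub_nonneg] at this
          exact le_add_of_nonneg_left this
        have h2 : f (z - z ⊓ y k) ≤ f.pos (y i₀ - y k) :=
          (f.le_pos _ (sub_nonneg.2 inf_le_left)).trans (RieszDual.mono f.pos_nonneg h1)
        rw [map_sub, map_sub] at h2
        have h3 : c ≤ f.pos (y k) := hc ⟨k, rfl⟩
        have h4 := (le_abs_self _).trans (hsz k)
        have h5 := hs hjk
        linarith
      linarith
    rw [← f.pos_apply (hyn i₀)] at key
    linarith
  · have h := abs_le'.1 (hxy i)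
    refine abs_le'.2 ⟨RieszDual.mono f.pos_nonneg h.1, ?_⟩
    have := RieszDual.mono f.pos_nonneg h.2
    rwa [map_neg] at this

namespace NormalDual

noncomputable instance : AddCommGroup (NormalDual E) :=
  inferInstanceAs (AddCommGroup ↥(orderContinuousFunctionals E))

noncomputable instance : Module ℝ (NormalDual E) :=
  inferInstanceAs (Module ℝ ↥(orderContinuousFunctionals E))

/-- The inclusion of `E~_n` in `E~`. -/
def toDual (F : NormalDual E) : RieszDual E := F.1

noncomputable instance : Lattice (NormalDual E) :=
  Subtype.lattice
    (fun _ _ hf hg => (orderContinuousFunctionals E).add_mem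
      (IsOrderContinuous.pos ((orderContinuousFunctionals E).sub_mem hf hg)) hg)
    (fun _ _ hf hg => (orderContinuousFunctionals E).sub_mem hf
      (IsOrderContinuous.pos ((orderContinuousFunctionals E).sub_mem hf hg)))

theorem isOrderContinuous (F : NormalDual E) : IsOrderContinuous F.toDual := F.2

theorem toDual_le {F G : NormalDual E} : F.toDual ≤ G.toDual ↔ F ≤ G := Iff.rfl

@[simp] theorem toDual_add (F G : NormalDual E) : (F + G).toDual = F.toDual + G.toDual := rfl

@[simp] theorem toDual_neg (F : NormalDual E) : (-F).toDual = -F.toDual := rfl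

@[simp] theorem toDual_abs (F : NormalDual E) : |F|.toDual = |F.toDual| := rfl

instance : IsOrderedAddMonoid (NormalDual E) where
  add_le_add_left F G h K := toDual_le.1 (by
    simpa using add_le_add_left (toDual_le.2 h) K.toDual)

instance : IsOrderedModule ℝ (NormalDual E) where
  smul_le_smul_of_nonneg_left := fun _ hr _ _ h =>
    toDual_le.1 (smul_le_smul_of_nonneg_left (toDual_le.2 h) hr)
  smul_le_smul_of_nonneg_right := fun _ hF _ _ h =>
    toDual_le.1 (smul_le_smul_of_nonneg_right h (toDual_le.2 hF))

end NormalDual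

end NormalDual

/-! ### The two module actions -/

section Action

variable {A : Type u} [NonUnitalRing A] [Lattice A] [IsOrderedAddMonoid A] [Module ℝ A]
  [IsOrderedModule ℝ A] [IsScalarTower ℝ A A] [SMulCommClass ℝ A A] [IsFAlgebra A]

theorem IsFAlgebra.mul_le_mul_left {a x y : A} (ha : 0 ≤ a) (h : x ≤ y) : a * x ≤ a * y := by
  have := IsFAlgebra.mul_nonneg a (y - x) ha (sub_nonneg.2 h)
  rwa [mul_sub, sub_nonneg] at this

theorem IsFAlgebra.mul_le_mul_right {a x y : A} (ha : 0 ≤ a) (h : x ≤ y) : x * a ≤ y * a := by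
  have := IsFAlgebra.mul_nonneg (y - x) a (sub_nonneg.2 h) ha
  rwa [sub_mul, sub_nonneg] at this

/-- For `f ∈ A~` and `a ∈ A`, the functional `f · a ∈ A~` with `(f · a) b = f (a * b)`. -/
noncomputable def dualActElem (f : RieszDual A) (a : A) : RieszDual A :=
  RieszDual.mk (f.toLin ∘ₗ LinearMap.mulLeft ℝ a) (by
    intro u v
    obtain ⟨c, d, h⟩ := f.bounded (a⁺ * u) (a⁺ * v)
    obtain ⟨c', d', h'⟩ := f.bounded (a⁻ * u) (a⁻ * v)
    refine ⟨c - d', d - c', fun x hx hx' => ?_⟩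
    have e : f (a * x) = f (a⁺ * x) - f (a⁻ * x) := by
      rw [← map_sub, ← sub_mul, posPart_sub_negPart]
    have h1 := h (a⁺ * x) (IsFAlgebra.mul_le_mul_left (posPart_nonneg a) hx)
      (IsFAlgebra.mul_le_mul_left (posPart_nonneg a) hx')
    have h2 := h' (a⁻ * x) (IsFAlgebra.mul_le_mul_left (negPart_nonneg a) hx)
      (IsFAlgebra.mul_le_mul_left (negPart_nonneg a) hx')
    change c - d' ≤ f (a * x) ∧ f (a * x) ≤ d - c'
    rw [e]
    constructor <;> linarith [h1.1, h1.2, h2.1, h2.2])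

@[simp] theorem dualActElem_apply (f : RieszDual A) (a b : A) :
    dualActElem f a b = f (a * b) := rfl

/-- The map `a ↦ f · a`, linear in `a`. -/
noncomputable def dualActElemLin (f : RieszDual A) : A →ₗ[ℝ] RieszDual A where
  toFun a := dualActElem f a
  map_add' a b := RieszDual.ext_apply fun x => by simp [add_mul]
  map_smul' r a := RieszDual.ext_apply fun x => by simp [smul_mul_assoc]

@[simp] theorem dualActElemLin_apply (f : RieszDual A) (a : A) :
    dualActElemLin f a = dualActElem f a := rfl

theorem dualActElem_mono {f : RieszDual A} (hf : 0 ≤ f) {a b : A} (h : a ≤ b) :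
    dualActElem f a ≤ dualActElem f b := fun x hx => by
  simpa using RieszDual.mono hf (IsFAlgebra.mul_le_mul_right hx h)

/-- For `F ∈ (A~)~_n` and `f ∈ A~`, the functional `F · f ∈ A~` with `(F · f) a = F (f · a)`. -/
noncomputable def bidualAct (F : NormalDual (RieszDual A)) (f : RieszDual A) : RieszDual A :=
  RieszDual.mk (F.toDual.toLin ∘ₗ dualActElemLin f) (by
    intro u v
    obtain ⟨c, d, h⟩ := F.toDual.bounded (dualActElem f⁺ u - dualActElem f⁻ v)
      (dualActElem f⁺ v - dualActElem f⁻ u)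
    refine ⟨c, d, fun x hx hx' => ?_⟩
    have e : dualActElem f x = dualActElem f⁺ x - dualActElem f⁻ x :=
      RieszDual.ext_apply fun y => by
        rw [RieszDual.sub_apply, dualActElem_apply, dualActElem_apply, dualActElem_apply,
          ← RieszDual.sub_apply, posPart_sub_negPart]
    apply h
    · rw [dualActElemLin_apply, e]
      exact sub_le_sub (dualActElem_mono (posPart_nonneg f) hx)
        (dualActElem_mono (negPart_nonneg f) hx')
    · rw [dualActElemLin_apply, e]
      exact sub_le_sub (dualActElem_mono (posPart_nonneg f) hx')
        (dualActElem_mono (negPart_nonneg f) hx))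

@[simp] theorem bidualAct_apply (F : NormalDual (RieszDual A)) (f : RieszDual A) (a : A) :
    bidualAct F f a = F.toDual (dualActElem f a) := rfl

end Action

open Filter Topology

/-
For `F ≥ 0` the map `f ↦ F · f` is a positive orthomorphism of `A~`, and for `f ≥ 0` the map
`F ↦ F · f` sends disjoint elements to disjoint elements; the theorem is then lattice-group
algebra. Both facts come from one estimate: multiplication `T` by a nonnegative element satisfies
`T x ≤ x + T (T x)` for `x ≥ 0`, so that, after scaling by `t > 0`,
`f (x * y) ≤ t * f x + t⁻¹ * f (x * y * y)` and `f · x ≤ t • f + t⁻¹ • (f · x²)` for `f ≥ 0`.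

* If `f ⊥ g`, then below every `x ≥ 0` there is a decreasing sequence `c` with `f (c m) → 0` and
  `g (x - c m)` small. The first estimate gives `f · c m ↓ 0`, so `(F · f) (c m) → 0` by order
  continuity, and `F · f ⊥ g`.
* If `F ⊥ G`, then `f = p + q` with `F p` and `G q` small. Replacing `p`, `q` by the disjoint
  elements `p - p ⊓ q`, `q - p ⊓ q` bounds `F · f ⊓ G · f` by `2 (F · p + G · q)`, which is small
  by the second estimate.
-/

section LatticeGroup

variable {M N P : Type*}
  [AddCommGroup M] [Lattice M] [IsOrderedAddMonoid M]
  [AddCommGroup N] [Lattice N] [IsOrderedAddMonoid N]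
  [AddCommGroup P] [Lattice P] [IsOrderedAddMonoid P]

theorem RieszDisjoint.abs_sub {u v : M} (h : RieszDisjoint u v) : |u - v| = |u| + |v| := by
  apply le_antisymm
  · simpa only [sub_eq_add_neg, abs_neg] using abs_add_le u (-v)
  · calc |u| + |v| = |u| ⊔ |v| - |u| ⊓ |v| := by rw [← inf_add_sup, h, zero_add, sub_zero]
      _ = |(|u| - |v|)| := by rw [sup_sub_inf_eq_abs_sub, abs_sub_comm]
      _ ≤ |u - v| := abs_abs_sub_abs_le u v

theorem rieszDisjoint_of_inf_eq_zero {u v : M} (h : u ⊓ v = 0) : RieszDisjoint u v := by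
  rwa [RieszDisjoint, abs_of_nonneg (h.ge.trans inf_le_left),
    abs_of_nonneg (h.ge.trans inf_le_right)]

theorem add_inf_add_le {a b v w : M} (hv : 0 ≤ v) (hw : 0 ≤ w) :
    (a + v) ⊓ (b + w) ≤ a ⊓ b + (v + w) := by
  rw [inf_add]
  exact inf_le_inf (add_le_add_right (le_add_of_nonneg_right hw) a)
    (add_le_add_right (le_add_of_nonneg_left hv) b)

theorem sub_finset_inf'_le_sum {ι : Type*} {s : Finset ι} (hs : s.Nonempty) {b : ι → M} {x : M}
    (hb : ∀ i ∈ s, b i ≤ x) : x - s.inf' hs b ≤ ∑ i ∈ s, (x - b i) := by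
  refine sub_le_comm.1 (Finset.le_inf' hs b fun i hi => sub_le_comm.1 ?_)
  exact Finset.single_le_sum (f := fun i => x - b i) (fun j hj => sub_nonneg.2 (hb j hj)) hi

theorem abs_map_of_inf_eq_zero {T : M →+ P} (hT : ∀ x y, x ⊓ y = 0 → T x ⊓ T y = 0) (x : M) :
    |T x| = T |x| := by
  have hdisj : T x⁺ ⊓ T x⁻ = 0 := hT _ _ (posPart_inf_negPart_eq_zero x)
  calc |T x| = |T x⁺ - T x⁻| := by rw [← map_sub, posPart_sub_negPart]
    _ = T x⁺ + T x⁻ := by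
      rw [(rieszDisjoint_of_inf_eq_zero hdisj).abs_sub, abs_of_nonneg (hdisj.ge.trans inf_le_left),
        abs_of_nonneg (hdisj.ge.trans inf_le_right)]
    _ = T |x| := by rw [← map_add, posPart_add_negPart]

theorem abs_map_map_of_inf_eq_zero {B : M →+ N →+ P}
    (hleft : ∀ x x' y, x ⊓ x' = 0 → 0 ≤ y → B x y ⊓ B x' y = 0)
    (hright : ∀ x y y', 0 ≤ x → y ⊓ y' = 0 → B x y ⊓ B x y' = 0) (x : M) (y : N) :
    |B x y| = B |x| |y| := by
  have habs (y : N) (hy : 0 ≤ y) : |B x y| = B |x| y :=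
    abs_map_of_inf_eq_zero (T := B.flip y) (fun x x' h => hleft x x' y h hy) x
  have hdisj : RieszDisjoint (B x y⁺) (B x y⁻) := by
    rw [RieszDisjoint, habs _ (posPart_nonneg y), habs _ (negPart_nonneg y)]
    exact hright _ _ _ (abs_nonneg x) (posPart_inf_negPart_eq_zero y)
  calc |B x y| = |B x y⁺ - B x y⁻| := by rw [← map_sub, posPart_sub_negPart]
    _ = B |x| y⁺ + B |x| y⁻ := by
      rw [hdisj.abs_sub, habs _ (posPart_nonneg y), habs _ (negPart_nonneg y)]
    _ = B |x| |y| := by rw [← map_add, posPart_add_negPart]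

end LatticeGroup

section PositiveOrthomorphism

variable {M : Type*} [AddCommGroup M] [Lattice M]

/-- Positive orthomorphisms of a lattice-ordered group: additive maps `T` such that `a ⊓ b = 0`
implies `T a ⊓ b = 0`. Positivity is the case `b = 0`. -/
def IsPositiveOrthomorphism (T : M →+ M) : Prop := ∀ ⦃a b⦄, a ⊓ b = 0 → T a ⊓ b = 0

namespace IsPositiveOrthomorphism

variable {S T : M →+ M}

theorem map_nonneg (hT : IsPositiveOrthomorphism T) {x : M} (hx : 0 ≤ x) : 0 ≤ T x :=
  inf_eq_right.1 (hT (inf_eq_right.2 hx))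

theorem map_inf_map_eq_zero (hS : IsPositiveOrthomorphism S) (hT : IsPositiveOrthomorphism T)
    {a b : M} (h : a ⊓ b = 0) : S a ⊓ T b = 0 := by
  have hSa : b ⊓ S a = 0 := (inf_comm _ _).trans (hS h)
  exact (inf_comm _ _).trans (hT hSa)

variable [IsOrderedAddMonoid M]

theorem monotone (hT : IsPositiveOrthomorphism T) : Monotone T := fun x y h => by
  simpa only [map_sub, sub_nonneg] using hT.map_nonneg (sub_nonneg.2 h)

theorem map_le_add_map_map (hT : IsPositiveOrthomorphism T) {x : M} (hx : 0 ≤ x) :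
    T x ≤ x + T (T x) := by
  set v := T x - x with hv
  have hneg : v⁻ ≤ x := by
    rw [negPart_def, hv, neg_sub]
    exact sup_le (sub_le_self x (hT.map_nonneg hx)) hx
  have hdisj : T v⁻ ⊓ v⁺ = 0 := hT ((inf_comm _ _).trans (posPart_inf_negPart_eq_zero v))
  have hTneg : T v⁻ ≤ x := by
    rw [← sub_nonpos, ← hdisj]
    exact le_inf (sub_le_self _ hx) ((sub_le_sub_right (hT.monotone hneg) x).trans (le_posPart v))
  have hTv : -x ≤ T v := calc
    -x ≤ -T v⁻ := neg_le_neg hTneg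
    _ ≤ T v⁺ - T v⁻ := by
      rw [sub_eq_add_neg]; exact le_add_of_nonneg_left (hT.map_nonneg (posPart_nonneg v))
    _ = T v := by rw [← map_sub, posPart_sub_negPart]
  rwa [hv, map_sub, neg_le_sub_iff_le_add'] at hTv

theorem map_add_inf_map_add_le (hS : IsPositiveOrthomorphism S) (hT : IsPositiveOrthomorphism T)
    {p q : M} (hp : 0 ≤ p) (hq : 0 ≤ q) :
    S (p + q) ⊓ T (p + q) ≤ 2 • (S p + T q) := by
  set r := p ⊓ q
  have hr : 0 ≤ r := le_inf hp hq
  have hdisj : (q - r) ⊓ (p - r) = 0 := by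
    rw [inf_comm, sub_eq_add_neg, sub_eq_add_neg, ← inf_add, add_neg_cancel]
  have hSpq : S (p + q) = S (q - r) + S (p + r) := by rw [← map_add]; congr 1; abel
  have hTpq : T (p + q) = T (p - r) + T (q + r) := by rw [← map_add]; congr 1; abel
  calc S (p + q) ⊓ T (p + q)
      ≤ S (q - r) ⊓ T (p - r) + (S (p + r) + T (q + r)) := by
        rw [hSpq, hTpq]
        exact add_inf_add_le (hS.map_nonneg (add_nonneg hp hr)) (hT.map_nonneg (add_nonneg hq hr))
    _ = S (p + r) + T (q + r) := by rw [hS.map_inf_map_eq_zero hT hdisj, zero_add]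
    _ ≤ S (p + p) + T (q + q) := add_le_add (hS.monotone (add_le_add_right inf_le_left p))
        (hT.monotone (add_le_add_right inf_le_right q))
    _ = 2 • (S p + T q) := by rw [map_add, map_add]; abel

end IsPositiveOrthomorphism

end PositiveOrthomorphism

theorem nonpos_of_forall_le_mul_add_inv_mul {a K : ℝ}
    (h : ∀ t > 0, ∀ δ > 0, a ≤ t * δ + t⁻¹ * K) : a ≤ 0 := by
  have hle (t : ℝ) (ht : 0 < t) : a ≤ t⁻¹ * K := le_of_forall_pos_le_add fun ε hε => by
    have := h t ht (ε / t) (div_pos hε ht)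
    rwa [mul_div_cancel₀ _ ht.ne', add_comm] at this
  have hlim : Tendsto (fun t : ℝ => t⁻¹ * K) atTop (𝓝 0) := by
    simpa only [zero_mul] using tendsto_inv_atTop_zero.mul_const K
  exact ge_of_tendsto hlim ((eventually_gt_atTop 0).mono hle)

section RieszSpace

variable {E : Type u} [AddCommGroup E] [Lattice E] [IsOrderedAddMonoid E] [Module ℝ E]
  [IsOrderedModule ℝ E]

namespace RieszDual

theorem inf_apply_le (f g : RieszDual E) {x b : E} (hb : 0 ≤ b) (hbx : b ≤ x) :
    (f ⊓ g) x ≤ f b + g (x - b) := calc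
  (f ⊓ g) x = (f ⊓ g) b + (f ⊓ g) (x - b) := by rw [← map_add, add_sub_cancel]
  _ ≤ f b + g (x - b) := add_le_add ((inf_le_left : f ⊓ g ≤ f) b hb)
    ((inf_le_right : f ⊓ g ≤ g) _ (sub_nonneg.2 hbx))

theorem exists_add_apply_sub_lt {f g : RieszDual E} {x : E} (hx : 0 ≤ x) {r : ℝ}
    (h : (f ⊓ g) x < r) : ∃ b, 0 ≤ b ∧ b ≤ x ∧ f b + g (x - b) < r := by
  by_contra! hcon
  have hle : (f - g).posVal x ≤ f x - r := by
    refine posVal_le _ hx fun y hy hyx => ?_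
    have := hcon (x - y) (sub_nonneg.2 hyx) (sub_le_self _ hy)
    rw [sub_sub_cancel, map_sub] at this
    rw [sub_apply]
    linarith
  rw [inf_def, sub_apply, pos_apply _ hx] at h
  linarith

theorem exists_antitone_of_inf_eq_zero {f g : RieszDual E} (h : f ⊓ g = 0) {x : E} (hx : 0 ≤ x)
    {ε : ℝ} (hε : 0 < ε) :
    ∃ c : ℕ → E, Antitone c ∧ (∀ m, 0 ≤ c m) ∧ (∀ m, c m ≤ x) ∧
      Tendsto (fun m => f (c m)) atTop (𝓝 0) ∧ ∀ m, g (x - c m) ≤ ε := by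
  have hf : 0 ≤ f := h.ge.trans inf_le_left
  have hg : 0 ≤ g := h.ge.trans inf_le_right
  obtain ⟨δ, hδ, s, hδs, hsε⟩ := posSumOfEncodable hε ℕ
  choose b hb hbx hbδ using fun k =>
    exists_add_apply_sub_lt (f := f) (g := g) hx ((congrArg (· x) h).trans_lt (hδ k))
  have hfb (k) : f (b k) ≤ δ k := by linarith [hbδ k, nonneg_apply hg (sub_nonneg.2 (hbx k))]
  have hgb (k) : g (x - b k) ≤ δ k := by linarith [hbδ k, nonneg_apply hf (hb k)]
  let c (m : ℕ) : E := (Finset.range (m + 1)).inf' Finset.nonempty_range_add_one b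
  have hc (m) : 0 ≤ c m := Finset.le_inf' _ _ fun k _ => hb k
  have hcb (m) : c m ≤ b m := Finset.inf'_le b (Finset.self_mem_range_succ m)
  refine ⟨c, fun i j hij => Finset.inf'_mono b (by gcongr) _, hc,
    fun m => (hcb m).trans (hbx m), ?_, fun m => ?_⟩
  · exact squeeze_zero (fun m => nonneg_apply hf (hc m))
      (fun m => (mono hf (hcb m)).trans (hfb m)) hδs.summable.tendsto_atTop_zero
  · calc g (x - c m) ≤ g (∑ k ∈ Finset.range (m + 1), (x - b k)) :=
          mono hg (sub_finset_inf'_le_sum _ fun k _ => hbx k)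
      _ = ∑ k ∈ Finset.range (m + 1), g (x - b k) := map_sum _ _ _
      _ ≤ ∑ k ∈ Finset.range (m + 1), δ k := Finset.sum_le_sum fun k _ => hgb k
      _ ≤ s := sum_le_hasSum _ (fun k _ => (hδ k).le) hδs
      _ ≤ ε := hsε

end RieszDual

-- Order continuity quantifies over index types in the universe of `E`, hence the `ULift`.
theorem NormalDual.tendsto_zero_of_isGLB (F : NormalDual E) {c : ℕ → E} (hc : Antitone c)
    (h : IsGLB (Set.range c) 0) : Tendsto (fun m => F.toDual (c m)) atTop (𝓝 0) := by
  let c' (i : ULift.{u} ℕ) : E := c i.down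
  have hc' : OrderTendstoZero c' :=
    ⟨c', fun _ _ hij => hc hij, (ULift.down_surjective.range_comp c).symm ▸ h,
      fun i => (abs_of_nonneg (h.1 ⟨i.down, rfl⟩)).le⟩
  have : IsDirected (ULift.{u} ℕ) (· ≤ ·) :=
    ⟨fun i j => ⟨⟨max i.down j.down⟩, le_max_left i.down j.down, le_max_right i.down j.down⟩⟩
  obtain ⟨y, hy, hy0, hcy⟩ := F.isOrderContinuous (ULift.{u} ℕ) c' hc'
  have hlim : Tendsto (fun m : ℕ => y ⟨m⟩) atTop (𝓝 0) :=
    tendsto_atTop_isGLB (fun _ _ hij => hy hij) ((ULift.up_surjective.range_comp y).symm ▸ hy0)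
  exact squeeze_zero_norm (fun m => hcy ⟨m⟩) hlim

end RieszSpace

section FAlgebra

variable {A : Type u} [NonUnitalRing A] [Lattice A] [IsOrderedAddMonoid A] [Module ℝ A]
  [IsOrderedModule ℝ A] [IsScalarTower ℝ A A] [SMulCommClass ℝ A A] [IsFAlgebra A]

theorem IsFAlgebra.isPositiveOrthomorphism_mulLeft {c : A} (hc : 0 ≤ c) :
    IsPositiveOrthomorphism (AddMonoidHom.mulLeft c) :=
  fun a b h => IsFAlgebra.mul_left_inf a b c h hc

theorem IsFAlgebra.isPositiveOrthomorphism_mulRight {c : A} (hc : 0 ≤ c) :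
    IsPositiveOrthomorphism (AddMonoidHom.mulRight c) :=
  fun a b h => IsFAlgebra.mul_right_inf a b c h hc

theorem RieszDual.apply_mul_le {f : RieszDual A} (hf : 0 ≤ f) {x y : A} (hx : 0 ≤ x)
    (hy : 0 ≤ y) {t : ℝ} (ht : 0 < t) : f (x * y) ≤ t * f x + t⁻¹ * f (x * y * y) := by
  have h : x * (t⁻¹ • y) ≤ x + x * (t⁻¹ • y) * (t⁻¹ • y) :=
    (IsFAlgebra.isPositiveOrthomorphism_mulRight
      (smul_nonneg (inv_nonneg.2 ht.le) hy)).map_le_add_map_map hx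
  have hfle := RieszDual.mono hf h
  simp only [mul_smul_comm, smul_mul_assoc, map_add, map_smul, smul_eq_mul] at hfle
  calc f (x * y) = t * (t⁻¹ * f (x * y)) := by field_simp
    _ ≤ t * (f x + t⁻¹ * (t⁻¹ * f (x * y * y))) := by gcongr
    _ = t * f x + t⁻¹ * f (x * y * y) := by field_simp

theorem dualActElem_nonneg {f : RieszDual A} (hf : 0 ≤ f) {a : A} (ha : 0 ≤ a) :
    0 ≤ dualActElem f a :=
  fun _ hx => RieszDual.nonneg_apply hf (IsFAlgebra.mul_nonneg _ _ ha hx)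

theorem dualActElem_le_smul_add_smul {f : RieszDual A} (hf : 0 ≤ f) {x : A} (hx : 0 ≤ x) {t : ℝ}
    (ht : 0 < t) : dualActElem f x ≤ t • f + t⁻¹ • dualActElem f (x * x) := fun y hy => by
  have h : (t⁻¹ • x) * y ≤ y + (t⁻¹ • x) * ((t⁻¹ • x) * y) :=
    (IsFAlgebra.isPositiveOrthomorphism_mulLeft
      (smul_nonneg (inv_nonneg.2 ht.le) hx)).map_le_add_map_map hy
  have hfle := RieszDual.mono hf h
  simp only [mul_smul_comm, smul_mul_assoc, map_add, map_smul, smul_eq_mul] at hfle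
  calc f (x * y) = t * (t⁻¹ * f (x * y)) := by field_simp
    _ ≤ t * (f y + t⁻¹ * (t⁻¹ * f (x * (x * y)))) := by gcongr
    _ = t * f y + t⁻¹ * f (x * x * y) := by rw [mul_assoc]; field_simp

theorem isGLB_range_dualActElem {f : RieszDual A} (hf : 0 ≤ f) {ι : Type*} {l : Filter ι} [l.NeBot]
    {c : ι → A} {x : A} (hc : ∀ i, 0 ≤ c i) (hcx : ∀ i, c i ≤ x)
    (hfc : Tendsto (fun i => f (c i)) l (𝓝 0)) :
    IsGLB (Set.range fun i => dualActElem f (c i)) 0 := by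
  refine ⟨Set.forall_mem_range.2 fun i => dualActElem_nonneg hf (hc i), fun w hw y hy => ?_⟩
  refine nonpos_of_forall_le_mul_add_inv_mul (K := f (x * y * y)) fun t ht δ hδ => ?_
  obtain ⟨i, hi⟩ := (hfc.eventually_lt_const hδ).exists
  have hcxy : c i * y * y ≤ x * y * y :=
    IsFAlgebra.mul_le_mul_right hy (IsFAlgebra.mul_le_mul_right hy (hcx i))
  calc w y ≤ f (c i * y) := hw ⟨i, rfl⟩ y hy
    _ ≤ t * f (c i) + t⁻¹ * f (c i * y * y) := RieszDual.apply_mul_le hf (hc i) hy ht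
    _ ≤ t * δ + t⁻¹ * f (x * y * y) := by gcongr; exact RieszDual.mono hf hcxy

/-- The action `(F, f) ↦ F · f` as a biadditive map. -/
noncomputable def bidualActHom : NormalDual (RieszDual A) →+ RieszDual A →+ RieszDual A :=
  AddMonoidHom.mk'
    (fun F => AddMonoidHom.mk' (bidualAct F) fun f g => RieszDual.ext_apply fun a => by
      have hadd : dualActElem (f + g) a = dualActElem f a + dualActElem g a :=
        RieszDual.ext_apply fun _ => rfl
      simp only [bidualAct_apply, hadd, map_add, RieszDual.add_apply])
    fun _ _ => rfl

theorem bidualAct_nonneg {F : NormalDual (RieszDual A)} (hF : 0 ≤ F) {f : RieszDual A}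
    (hf : 0 ≤ f) : 0 ≤ bidualAct F f :=
  fun _ hx => RieszDual.nonneg_apply (NormalDual.toDual_le.2 hF) (dualActElem_nonneg hf hx)

theorem bidualAct_apply_le {F : NormalDual (RieszDual A)} (hF : 0 ≤ F) {f : RieszDual A}
    (hf : 0 ≤ f) {x : A} (hx : 0 ≤ x) {t : ℝ} (ht : 0 < t) :
    bidualAct F f x ≤ t * F.toDual f + t⁻¹ * bidualAct F f (x * x) := by
  simpa only [bidualAct_apply, map_add, map_smul, smul_eq_mul] using
    RieszDual.mono (NormalDual.toDual_le.2 hF) (dualActElem_le_smul_add_smul hf hx ht)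

theorem isPositiveOrthomorphism_bidualActHom {F : NormalDual (RieszDual A)} (hF : 0 ≤ F) :
    IsPositiveOrthomorphism (bidualActHom F) := fun f g h => by
  have hf : 0 ≤ f := h.ge.trans inf_le_left
  have hg : 0 ≤ g := h.ge.trans inf_le_right
  refine le_antisymm (fun x hx => le_of_forall_pos_le_add fun ε hε => ?_)
    (le_inf (bidualAct_nonneg hF hf) hg)
  obtain ⟨c, hc, hc0, hcx, hfc, hgc⟩ := RieszDual.exists_antitone_of_inf_eq_zero h hx hε
  have hlim : Tendsto (fun m => bidualAct F f (c m)) atTop (𝓝 0) :=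
    F.tendsto_zero_of_isGLB (fun _ _ hij => dualActElem_mono hf (hc hij))
      (isGLB_range_dualActElem hf hc0 hcx hfc)
  refine ge_of_tendsto' (hlim.add_const ε) fun m => ?_
  calc (bidualAct F f ⊓ g) x ≤ bidualAct F f (c m) + g (x - c m) :=
        RieszDual.inf_apply_le _ _ (hc0 m) (hcx m)
    _ ≤ bidualAct F f (c m) + ε := by gcongr; exact hgc m

theorem bidualAct_inf_bidualAct_eq_zero {F G : NormalDual (RieszDual A)} (h : F ⊓ G = 0)
    {f : RieszDual A} (hf : 0 ≤ f) : bidualAct F f ⊓ bidualAct G f = 0 := by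
  have hF : 0 ≤ F := h.ge.trans inf_le_left
  have hG : 0 ≤ G := h.ge.trans inf_le_right
  have hS := isPositiveOrthomorphism_bidualActHom hF
  have hT := isPositiveOrthomorphism_bidualActHom hG
  refine le_antisymm (fun x hx => ?_) (le_inf (bidualAct_nonneg hF hf) (bidualAct_nonneg hG hf))
  have hxx : 0 ≤ x * x := IsFAlgebra.mul_nonneg x x hx hx
  refine nonpos_of_forall_le_mul_add_inv_mul
    (K := 2 * (bidualAct F f (x * x) + bidualAct G f (x * x))) fun t ht δ hδ => ?_
  have hFG : (F.toDual ⊓ G.toDual) f < δ / 2 :=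
    (congrArg (fun H => H.toDual f) h).trans_lt (half_pos hδ)
  obtain ⟨p, hp, hpf, hpδ⟩ := RieszDual.exists_add_apply_sub_lt hf hFG
  set q := f - p
  have hq0 : 0 ≤ q := sub_nonneg.2 hpf
  have hpq : f = p + q := (add_sub_cancel p f).symm
  have hqf : q ≤ f := sub_le_self f hp
  have hle : bidualAct F f ⊓ bidualAct G f ≤ 2 • (bidualAct F p + bidualAct G q) := by
    conv_lhs => rw [hpq]
    exact hS.map_add_inf_map_add_le hT hp hq0
  have hFp : bidualAct F p (x * x) ≤ bidualAct F f (x * x) := hS.monotone hpf _ hxx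
  have hGq : bidualAct G q (x * x) ≤ bidualAct G f (x * x) := hT.monotone hqf _ hxx
  calc (bidualAct F f ⊓ bidualAct G f) x
      ≤ (2 • (bidualAct F p + bidualAct G q)) x := hle x hx
    _ = 2 * (bidualAct F p x + bidualAct G q x) := by
      rw [two_nsmul, two_mul, RieszDual.add_apply, RieszDual.add_apply]
    _ ≤ 2 * ((t * F.toDual p + t⁻¹ * bidualAct F p (x * x)) +
          (t * G.toDual q + t⁻¹ * bidualAct G q (x * x))) := by
      gcongr
      exacts [bidualAct_apply_le hF hp hx ht, bidualAct_apply_le hG hq0 hx ht]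
    _ = t * (2 * (F.toDual p + G.toDual q)) +
          t⁻¹ * (2 * (bidualAct F p (x * x) + bidualAct G q (x * x))) := by ring
    _ ≤ t * δ + t⁻¹ * (2 * (bidualAct F f (x * x) + bidualAct G f (x * x))) := by
      gcongr
      linarith

theorem abs_bidualAct (F : NormalDual (RieszDual A)) (f : RieszDual A) :
    |bidualAct F f| = bidualAct |F| |f| :=
  abs_map_map_of_inf_eq_zero (B := bidualActHom)
    (fun _ _ _ hFG hf => bidualAct_inf_bidualAct_eq_zero hFG hf)
    (fun _ _ _ hF hfg => (isPositiveOrthomorphism_bidualActHom hF).map_inf_map_eq_zero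
      (isPositiveOrthomorphism_bidualActHom hF) hfg) F f

theorem RieszDisjoint.bidualAct {f g : RieszDual A} (h : RieszDisjoint f g)
    (F G : NormalDual (RieszDual A)) : RieszDisjoint (bidualAct F f) (bidualAct G g) := by
  rw [RieszDisjoint, abs_bidualAct, abs_bidualAct]
  exact (isPositiveOrthomorphism_bidualActHom (abs_nonneg F)).map_inf_map_eq_zero
    (isPositiveOrthomorphism_bidualActHom (abs_nonneg G)) h

end FAlgebra

theorem corollary2p2_general {A : Type u} [NonUnitalRing A] [Lattice A] [IsOrderedAddMonoid A]
    [Module ℝ A] [IsOrderedModule ℝ A] [IsScalarTower ℝ A A] [SMulCommClass ℝ A A]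
    [IsFAlgebra A] :
    (∀ (F : NormalDual (RieszDual A)) (f : RieszDual A),
      |bidualAct F f| = bidualAct |F| |f|) ∧
    (∀ f g : RieszDual A, RieszDisjoint f g →
      ∀ F G : NormalDual (RieszDual A), RieszDisjoint (bidualAct F f) (bidualAct G g)) :=
  ⟨abs_bidualAct, fun _ _ h F G => h.bidualAct F G⟩

theorem corollary2p2 {A : Type u} [NonUnitalRing A] [Lattice A] [IsOrderedAddMonoid A]
    [Module ℝ A] [IsOrderedModule ℝ A] [IsScalarTower ℝ A A] [SMulCommClass ℝ A A] [IsFAlgebra A]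
    (hsep : ∀ a : A, (∀ f : RieszDual A, f a = 0) → a = 0) :
    (∀ (F : NormalDual (RieszDual A)) (f : RieszDual A),
      |bidualAct F f| = bidualAct |F| |f|) ∧
    (∀ f g : RieszDual A, RieszDisjoint f g →
      ∀ F G : NormalDual (RieszDual A), RieszDisjoint (bidualAct F f) (bidualAct G g)) :=
  corollary2p2_general
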